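/- **Theorem (Differential privacy of FedDL with gradient perturbation).** Let $\gamma>0$ and let $P$ clients hold data matrices $X_p\in\mathbb R^{m\times n_p}$ (data points are columns). For $Y\in\mathbb R^{m\times n_y}$ ("landmarks") and the Gaussian kernel $k(x,y)=\exp(-\gamma\|x-y\|_2^2)$, the local objective of client $p$ is $$f_p(Y)=\tfrac{1}{n_p(n_p-1)}\sum_{i\ne j}k\big((X_p)_{:,i},(X_p)_{:,j}\big)-\tfrac{2}{n_pn_y}\sum_{i,j}k\big((X_p)_{:,i},Y_{:,j}\big)+\tfrac1{n_y(n_y-1)}\sum_{i\neq j}k\big(Y_{:,i},Y_{:,j}\big),$$ and $\nabla f_p(Y)$ is its gradient with respect to the Frobenius inner product (a term whose double sum is empty is read as $0$). Two local data sets are neighbouring if they differ in at most one column; two federated data sets $(X_p)_p,(X_p')_p$ are neighbouring if they differ in at most one column of one client. Let $\tau_X,\tau_Y,\Upsilon$ be real numbers and put $$\Delta_p=\frac{8\sqrt{n_y}\,\gamma\tau_X}{n_pn_y}\Big\{1+2\gamma(\tau_X+\tau_Y)(\tau_X+\Upsilon)\Big\}.$$ (1) *Sensitivity.* For every client $p$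 and every $Y$ with spectral norm $\|Y\|_{sp}\le\tau_Y$, the $\ell_2$-sensitivity of $X_p\mapsto\nabla f_p(Y)$, that is, the supremum of the Frobenius norm of the difference of the gradients over neighbouring $X_p,X_p'$ whose columns have norm at most $\tau_X$ and distance at most $\Upsilon$ from every column of $Y$, is at most $\Delta_p$. (2) *Privacy.* Let $S\ge 0$, $\varepsilon>0$ and $\delta\in(0,1]$ with $\varepsilon\le 8\log(e+\varepsilon/\delta)$ (for example, any $0<\varepsilon\le 20$ and any $\delta\in(0,1]$). In each round $s=1,\dots,S$ every client $p$ releases $\nabla f_p(Y_p^s)+E_p^s$, where the entries of all $E_p^s$ are independent $\mathcal N(0,\sigma_p^2)$ variables with $$\sigma_p^2=\frac{8S\Delta_p^2\log(e+\varepsilon/\delta)}{\varepsilon^2},$$ and where $Y_p^s$ is chosen adaptively, as an arbitrary measurable function of the releases of all clients in the rounds before $s$, with $\|Y_p^s\|_{sp}\le\tau_Y$ always. Then the mechanism that maps the federated data set to all $S$ rounds of releases of all clients is $(\varepsilon,\delta)$-differentially private on the federated data sets with $\|(X_p)_{:,j}\|_2\le\tau_X$ and $\|(Y_p^s)_{:,i}-(X_p)_{:,j}\|_2\le\Upsilon$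 for all $p,i,j,s$ and all values that $Y_p^s$ can take: for neighbouring $X,X'$ among these and every measurable set $A$ of outputs, $\Pr[M(X)\in A]\le e^{\varepsilon}\Pr[M(X')\in A]+\delta$. -/

import Mathlib

open MeasureTheory ProbabilityTheory
open scoped ENNReal NNReal

noncomputable section

namespace FedDL

/-- Real `m × n` matrices with entry `A (k, j)` in row `k` and column `j`. The Euclidean structure on
the entries is the Frobenius inner product, so `‖A‖` is the Frobenius norm. -/
abbrev Mat (m n : ℕ) : Type := EuclideanSpace ℝ (Fin m × Fin n)

/-- The `j`-th column of a matrix, as a Euclidean vector. -/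
def col {m n : ℕ} (A : Mat m n) (j : Fin n) : EuclideanSpace ℝ (Fin m) :=
  WithLp.toLp 2 fun k => A (k, j)

/-- The spectral norm: the operator norm of `A` as a map between Euclidean spaces. -/
def spectralNorm {m n : ℕ} (A : Mat m n) : ℝ :=
  ‖LinearMap.toContinuousLinearMap (Matrix.toEuclideanLin (Matrix.of fun k j => A (k, j)))‖

/-- The Gaussian kernel `exp (-γ ‖x - y‖²)`. -/
def gaussianKernel {m : ℕ} (γ : ℝ) (x y : EuclideanSpace ℝ (Fin m)) : ℝ :=
  Real.exp (-γ * ‖x - y‖ ^ 2)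

/-- The finite-sample maximum mean discrepancy between the columns of `X` and the columns of `Y`. -/
def mmd {m nX nY : ℕ} (γ : ℝ) (X : Mat m nX) (Y : Mat m nY) : ℝ :=
  1 / ((nX : ℝ) * ((nX : ℝ) - 1)) *
      ∑ i : Fin nX, ∑ j ∈ Finset.univ.filter (fun j => j ≠ i), gaussianKernel γ (col X i) (col X j)
    - 2 / ((nX : ℝ) * (nY : ℝ)) *
      ∑ i : Fin nX, ∑ j : Fin nY, gaussianKernel γ (col X i) (col Y j)
    + 1 / ((nY : ℝ) * ((nY : ℝ) - 1)) *
      ∑ i : Fin nY, ∑ j ∈ Finset.univ.filter (fun j => j ≠ i), gaussianKernel γ (col Y i) (col Y j)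

/-- The gradient, at `Y`, of the local objective `mmd γ X` of a client holding the data `X`. -/
def localGradient {m nX nY : ℕ} (γ : ℝ) (X : Mat m nX) (Y : Mat m nY) : Mat m nY :=
  gradient (fun Z : Mat m nY => mmd γ X Z) Y

/-- Neighbouring local data sets: they differ in at most one column. -/
def ColumnAdjacent {m n : ℕ} (A B : Mat m n) : Prop :=
  ∃ j : Fin n, ∀ i : Fin n, i ≠ j → col A i = col B i

/-- Neighbouring federated data sets: they differ in at most one column of one client. -/
def Adjacent {P m : ℕ} {n : Fin P → ℕ} (X X' : ∀ p, Mat m (n p)) : Prop :=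
  ∃ p : Fin P, ColumnAdjacent (X p) (X' p) ∧ ∀ q : Fin P, q ≠ p → X q = X' q

/-- The `ℓ₂`-sensitivity of `g` on the data universe `D`: the supremum of `‖g x - g x'‖` over
neighbouring `x, x' ∈ D`. -/
def l2Sensitivity {α E : Type*} [PseudoEMetricSpace E] (D : Set α) (adj : α → α → Prop)
    (g : α → E) : ℝ≥0∞ :=
  ⨆ x ∈ D, ⨆ x' ∈ D, ⨆ _ : adj x x', edist (g x) (g x')

/-- `(ε, δ)`-differential privacy, on the data universe `D`, of the randomized mechanism that maps
a data set `x` to an output with law `M x`. -/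
def IsDifferentiallyPrivate {α β : Type*} [MeasurableSpace β] (D : Set α) (adj : α → α → Prop)
    (M : α → Measure β) (ε δ : ℝ) : Prop :=
  (∀ x ∈ D, IsProbabilityMeasure (M x)) ∧
    ∀ x ∈ D, ∀ x' ∈ D, adj x x' → ∀ E : Set β, MeasurableSet E →
      M x E ≤ ENNReal.ofReal (Real.exp ε) * M x' E + ENNReal.ofReal δ

/-- The local data sets with column norms at most `τX` and at distance at most `Υ`, column by column,
from the landmarks `Y`. -/
def localDomain {m nX nY : ℕ} (τX Υ : ℝ) (Y : Mat m nY) : Set (Mat m nX) :=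
  {X | (∀ j, ‖col X j‖ ≤ τX) ∧ ∀ i j, ‖col Y i - col X j‖ ≤ Υ}

/-- What all `P` clients together release in one round: one noisy gradient each. (The landmarks that
the clients use in one round have the same type.) -/
abbrev Round (P m nY : ℕ) : Type := Fin P → Mat m nY

/-- A rule for the landmarks: `Y s h p` is the landmark matrix at which client `p` evaluates its
gradient in round `s` (rounds are counted from `0`), after the releases `h` of all clients in the
rounds before `s`. -/
abbrev LandmarkRule (P m nY : ℕ) : Type := (s : ℕ) → (Fin s → Round P m nY) → Round P m nY

/-- The federated data sets with column norms at most `τX` and at distance at most `Υ`, column by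
column, from the landmarks that occur in the first `S` rounds. -/
def dataDomain {P m nY : ℕ} {n : Fin P → ℕ} (S : ℕ) (τX Υ : ℝ) (Y : LandmarkRule P m nY) :
    Set (∀ p, Mat m (n p)) :=
  {X | (∀ p j, ‖col (X p) j‖ ≤ τX) ∧
    ∀ s < S, ∀ h p i j, ‖col (Y s h p) i - col (X p) j‖ ≤ Υ}

/-- The bound `Δ` on the sensitivity of the gradient of a client with `nX` data points. -/
def sensitivityBound (nX nY : ℕ) (γ τX τY Υ : ℝ) : ℝ :=
  8 * √(nY : ℝ) * γ * τX / ((nX : ℝ) * (nY : ℝ)) * (1 + 2 * γ * (τX + τY) * (τX + Υ))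

/-- The noise variance `8 S Δ² log (e + ε / δ) / ε²`. -/
def noiseVariance (S : ℕ) (Δ ε δ : ℝ) : ℝ≥0 :=
  Real.toNNReal (8 * (S : ℝ) * Δ ^ 2 * Real.log (Real.exp 1 + ε / δ) / ε ^ 2)

/-- The law of a matrix with independent `N(0, v)` entries. -/
def gaussianMatrix (m n : ℕ) (v : ℝ≥0) : Measure (Mat m n) :=
  (Measure.pi fun _ : Fin m × Fin n => gaussianReal 0 v).map (WithLp.toLp 2)

/-- The joint law of the releases of all clients in the first `s` rounds on the data `X`: given the
releases `h` so far, client `p` releases in the next round its gradient at `Y s h p` plus a fresh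
Gaussian matrix with entries of variance `v p`, independently of everything else. -/
def releaseLaw {P m nY : ℕ} {n : Fin P → ℕ} (γ : ℝ) (v : Fin P → ℝ≥0) (Y : LandmarkRule P m nY)
    (X : ∀ p, Mat m (n p)) : (s : ℕ) → Measure (Fin s → Round P m nY)
  | 0 => Measure.dirac Fin.elim0
  | s + 1 =>
    ((releaseLaw γ v Y X s).prod (Measure.pi fun p => gaussianMatrix m nY (v p))).map
      fun hz => Fin.snoc (α := fun _ => Round P m nY) hz.1
        (fun p => localGradient γ (X p) (Y s hz.1 p) + hz.2 p)

end FedDL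

end

/-! Sensitivity: changing one data point `x` to `x'` affects the gradient only through the cross
term, whose `j`-th column is a multiple of `exp (-γ‖u‖²) u` at `u = x - y_j`. This map is
`1`-Lipschitz (`norm_exp_smul_sub_le`), so Cauchy–Schwarz over the columns gives a bound
proportional to `‖x - x'‖ ≤ 2τX`. It already lies below `Δ`, because the brace in `Δ` is at least
`1`.

Privacy: a Gaussian translated by `D` has a density with respect to the original whose `α`-th moment
is `exp (α(α-1)‖D‖²/(2v))`. Such moment bounds multiply under adaptive composition
(`RenyiBounded.prod_shift`): given the past, the landmarks are fixed and only the translation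
differs between the two data sets. Hence `S` rounds cost `α(α-1)ε²/(16L)` in the exponent, with `L =
log (e + ε/δ)`. A tangent-line inequality turns the moment bound into `(ε, δ')`-privacy
(`RenyiBounded.measure_le`), and the optimal order `α` makes `δ' ≤ δ` (`renyi_to_delta_le`). -/

namespace FedDL

/-! ### Densities of product measures. -/

section Pi

variable {ι : Type*} [Fintype ι] {E : ι → Type*} [∀ i, MeasurableSpace (E i)]

/-- Tonelli's theorem for a product of functions of one coordinate each. -/
theorem lintegral_pi_prod (μ : ∀ i, Measure (E i)) [∀ i, IsProbabilityMeasure (μ i)]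
    {f : ∀ i, E i → ℝ≥0∞} (hf : ∀ i, Measurable (f i)) :
    ∫⁻ x, ∏ i, f i (x i) ∂Measure.pi μ = ∏ i, ∫⁻ x, f i x ∂μ i := by
  have hind := iIndepFun_pi (μ := μ) (X := f) fun i => (hf i).aemeasurable
  refine (lintegral_prod_eq_prod_lintegral_of_indepFun Finset.univ
    (fun i (x : ∀ i, E i) => f i (x i)) hind fun i => (hf i).comp (measurable_pi_apply i)).trans ?_
  exact Finset.prod_congr rfl fun i _ =>
    (measurePreserving_eval μ i).lintegral_comp (hf i)

/-- The density of a product measure whose factors have densities. -/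
theorem pi_withDensity (μ : ∀ i, Measure (E i)) [∀ i, IsProbabilityMeasure (μ i)]
    {f : ∀ i, E i → ℝ≥0∞} (hf : ∀ i, Measurable (f i))
    [∀ i, IsProbabilityMeasure ((μ i).withDensity (f i))] :
    Measure.pi (fun i => (μ i).withDensity (f i))
      = (Measure.pi μ).withDensity fun x => ∏ i, f i (x i) := by
  refine Measure.pi_eq fun s hs => ?_
  rw [withDensity_apply _ (MeasurableSet.univ_pi hs), ← lintegral_indicator (MeasurableSet.univ_pi hs)]
  have : (Set.univ.pi s).indicator (fun x => ∏ i, f i (x i))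
      = fun x => ∏ i, (s i).indicator (f i) (x i) := by
    funext x
    by_cases hx : x ∈ Set.univ.pi s
    · rw [Set.indicator_of_mem hx]
      exact Finset.prod_congr rfl fun i _ => (Set.indicator_of_mem (hx i trivial) _).symm
    · rw [Set.indicator_of_notMem hx]
      obtain ⟨i, hi⟩ : ∃ i, x i ∉ s i := by simpa [Set.mem_pi] using hx
      exact (Finset.prod_eq_zero (Finset.mem_univ i) (Set.indicator_of_notMem hi _)).symm
  rw [this, lintegral_pi_prod μ fun i => (hf i).indicator (hs i)]
  refine Finset.prod_congr rfl fun i _ => ?_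
  rw [lintegral_indicator (hs i), withDensity_apply _ (hs i)]

/-- The density of a translate of a product measure. -/
theorem map_add_pi [∀ i, AddGroup (E i)] [∀ i, MeasurableAdd (E i)] (μ : ∀ i, Measure (E i))
    [∀ i, IsProbabilityMeasure (μ i)] {f : ∀ i, E i → ℝ≥0∞} (hf : ∀ i, Measurable (f i))
    (d : ∀ i, E i) (h : ∀ i, (μ i).map (· + d i) = (μ i).withDensity (f i)) :
    (Measure.pi μ).map (· + d) = (Measure.pi μ).withDensity fun x => ∏ i, f i (x i) := by
  have hm : ∀ i, Measurable fun x : E i => x + d i := fun i => measurable_add_const (d i)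
  have hp : ∀ i, IsProbabilityMeasure ((μ i).map (· + d i)) := fun i =>
    Measure.isProbabilityMeasure_map (hm i).aemeasurable
  have hp' : ∀ i, IsProbabilityMeasure ((μ i).withDensity (f i)) := fun i => h i ▸ hp i
  have := Measure.pi_map_pi (μ := μ) fun i => (hm i).aemeasurable
  rw [← pi_withDensity μ hf, ← funext h, ← this]
  rfl

end Pi

/-! ### Translated Gaussian noise: densities and their moments. -/

section Gaussian

/-- The density, with respect to `N(0, v)`, of its translate by `d`. -/
noncomputable def gaussianShift (v : ℝ≥0) (d z : ℝ) : ℝ≥0∞ :=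
  ENNReal.ofReal (Real.exp ((z * d - d ^ 2 / 2) / v))

theorem measurable_gaussianShift (v : ℝ≥0) (d : ℝ) : Measurable (gaussianShift v d) := by
  unfold gaussianShift
  fun_prop

theorem map_add_gaussianReal {v : ℝ≥0} {d : ℝ} (hd : v = 0 → d = 0) :
    (gaussianReal 0 v).map (· + d) = (gaussianReal 0 v).withDensity (gaussianShift v d) := by
  -- For `v = 0` the noise is a Dirac mass, `d = 0`, and division by zero makes the density `1`.
  by_cases hv : v = 0
  · have : gaussianShift v d = 1 := by
      funext z
      simp [gaussianShift, hv]
    rw [this, hd hv, withDensity_one]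
    simp
  · have hv' : (v : ℝ) ≠ 0 := by exact_mod_cast hv
    have hm : Measurable (gaussianShift v d) :=
      measurable_gaussianShift v _
    rw [gaussianReal_map_add_const, gaussianReal_of_var_ne_zero _ hv,
      gaussianReal_of_var_ne_zero _ hv, ← withDensity_mul _ (measurable_gaussianPDF 0 v) hm]
    congr 1
    funext z
    simp only [gaussianPDF, gaussianPDFReal, gaussianShift, Pi.mul_apply]
    rw [← ENNReal.ofReal_mul (by positivity), mul_assoc (√_)⁻¹, ← Real.exp_add]
    congr 3
    field_simp
    ring

/-- The `α`-th power is the exponential of an affine function of `z`, so the moment generating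
function contributes `α²d²/(2v)` and the constant term `-αd²/(2v)`. -/
theorem lintegral_gaussianShift_rpow (v : ℝ≥0) (d α : ℝ) :
    ∫⁻ z, gaussianShift v d z ^ α ∂gaussianReal 0 v
      = ENNReal.ofReal (Real.exp (α * (α - 1) * (d ^ 2 / (2 * v)))) := by
  have h : ∀ z, gaussianShift v d z ^ α
      = ENNReal.ofReal (Real.exp (-(α * d ^ 2 / (2 * v))) * Real.exp (α * d / v * z)) := fun z => by
    rw [gaussianShift, ENNReal.ofReal_rpow_of_pos (Real.exp_pos _), ← Real.exp_mul, ← Real.exp_add]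
    congr 2
    ring
  have hmgf := congrFun (mgf_fun_id_gaussianReal (μ := 0) (v := v)) (α * d / v)
  rw [mgf] at hmgf
  simp_rw [h]
  rw [← ofReal_integral_eq_lintegral_ofReal ((integrable_exp_mul_gaussianReal _).const_mul _)
    (Filter.Eventually.of_forall fun z => by positivity), integral_const_mul, hmgf, ← Real.exp_add]
  congr 2
  by_cases hv : v = 0
  · simp [hv]
  · have hv' : (v : ℝ) ≠ 0 := by exact_mod_cast hv
    field_simp
    ring

variable {P m n : ℕ}

instance (v : ℝ≥0) : IsProbabilityMeasure (gaussianMatrix m n v) :=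
  Measure.isProbabilityMeasure_map (WithLp.measurable_toLp 2 _).aemeasurable

/-- The density, with respect to `gaussianMatrix m n v`, of its translate by `D`. -/
noncomputable def matrixShift (v : ℝ≥0) (D Z : Mat m n) : ℝ≥0∞ :=
  ∏ i, gaussianShift v (D i) (Z i)

theorem measurable_matrixShift (v : ℝ≥0) (D : Mat m n) : Measurable (matrixShift v D) := by
  unfold matrixShift gaussianShift
  fun_prop

theorem map_add_gaussianMatrix {v : ℝ≥0} {D : Mat m n} (hD : v = 0 → D = 0) :
    (gaussianMatrix m n v).map (· + D) = (gaussianMatrix m n v).withDensity (matrixShift v D) := by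
  have hpi := map_add_pi (fun _ : Fin m × Fin n => gaussianReal 0 v)
    (f := fun i => gaussianShift v (D i))
    (fun i => measurable_gaussianShift v _) (fun i => D i)
    fun i => map_add_gaussianReal fun hv => by simp [hD hv]
  have hm := WithLp.measurable_toLp 2 (Fin m × Fin n → ℝ)
  have hφ : Measurable (matrixShift v D) := measurable_matrixShift v _
  ext A hA
  rw [gaussianMatrix, Measure.map_map (measurable_add_const D) hm, withDensity_apply _ hA,
    setLIntegral_map hA hφ hm, ← withDensity_apply _ (hm hA)]
  change _ = (Measure.pi fun _ => gaussianReal 0 v).withDensity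
    (fun x => ∏ i, gaussianShift v (D i) (x i)) _
  rw [← hpi, Measure.map_apply (measurable_add_const _) (hm hA),
    Measure.map_apply ((measurable_add_const D).comp hm) hA]
  rfl

theorem lintegral_matrixShift_rpow (v : ℝ≥0) (D : Mat m n) {α : ℝ} (hα : 0 ≤ α) :
    ∫⁻ Z, matrixShift v D Z ^ α ∂gaussianMatrix m n v
      = ENNReal.ofReal (Real.exp (α * (α - 1) * (‖D‖ ^ 2 / (2 * v)))) := by
  have hφ : Measurable (matrixShift v D) := measurable_matrixShift v _
  rw [gaussianMatrix, lintegral_map (hφ.pow_const α) (WithLp.measurable_toLp 2 _)]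
  simp only [matrixShift, ← ENNReal.prod_rpow_of_nonneg hα]
  rw [lintegral_pi_prod (fun _ => gaussianReal 0 v) (f := fun i z => gaussianShift v (D i) z ^ α)
    fun i => (measurable_gaussianShift v _).pow_const α]
  simp_rw [lintegral_gaussianShift_rpow]
  rw [← ENNReal.ofReal_prod_of_nonneg fun i _ => (Real.exp_pos _).le, ← Real.exp_sum,
    ← Finset.mul_sum, ← Finset.sum_div, EuclideanSpace.real_norm_sq_eq]

/-- The density, with respect to the noise of one round, of its translate by `D`. -/
noncomputable def roundShift (v : Fin P → ℝ≥0) (D Z : Round P m n) : ℝ≥0∞ :=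
  ∏ p, matrixShift (v p) (D p) (Z p)

theorem measurable_roundShift (v : Fin P → ℝ≥0) :
    Measurable fun q : Round P m n × Round P m n => roundShift v q.1 q.2 := by
  unfold roundShift matrixShift gaussianShift
  fun_prop

theorem map_add_pi_gaussianMatrix {v : Fin P → ℝ≥0} {D : Round P m n}
    (hD : ∀ p, v p = 0 → D p = 0) :
    (Measure.pi fun p => gaussianMatrix m n (v p)).map (· + D)
      = (Measure.pi fun p => gaussianMatrix m n (v p)).withDensity (roundShift v D) :=
  map_add_pi _ (fun p => measurable_matrixShift (v p) _) D
    fun p => map_add_gaussianMatrix (hD p)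

theorem lintegral_roundShift_rpow (v : Fin P → ℝ≥0) (D : Round P m n) {α : ℝ} (hα : 0 ≤ α) :
    ∫⁻ Z, roundShift v D Z ^ α ∂(Measure.pi fun p => gaussianMatrix m n (v p))
      = ENNReal.ofReal (Real.exp (α * (α - 1) * ∑ p, ‖D p‖ ^ 2 / (2 * v p))) := by
  simp only [roundShift, ← ENNReal.prod_rpow_of_nonneg hα]
  rw [lintegral_pi_prod _ (f := fun p Z => matrixShift (v p) (D p) Z ^ α)
    fun p => (measurable_matrixShift (v p) _).pow_const α]
  simp_rw [lintegral_matrixShift_rpow _ _ hα]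
  rw [← ENNReal.ofReal_prod_of_nonneg fun i _ => (Real.exp_pos _).le, ← Real.exp_sum,
    ← Finset.mul_sum]

end Gaussian

/-! ### Moment bounds on densities: conversion, post-processing, composition. -/

section Renyi

variable {β E W : Type*} [MeasurableSpace β] [MeasurableSpace E] [MeasurableSpace W]

/-- `μ` has a density with respect to `ν` whose `α`-th moment is at most `C`. (So the Rényi
divergence of order `α` from `ν` to `μ` is at most `log C / (α - 1)`.) -/
def RenyiBounded (α : ℝ) (C : ℝ≥0∞) (μ ν : Measure β) : Prop :=
  ∃ f : β → ℝ≥0∞, Measurable f ∧ μ = ν.withDensity f ∧ ∫⁻ x, f x ^ α ∂ν ≤ C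

theorem RenyiBounded.refl (α : ℝ) (μ : Measure β) [IsProbabilityMeasure μ] :
    RenyiBounded α 1 μ μ :=
  ⟨1, measurable_one, withDensity_one.symm, by simp⟩

/-- Convexity of the power function: Bernoulli's inequality bounds `(y / exp ε) ^ α` below by its
tangent at `1`. The factor `1 / α` comes from the slope, and it later absorbs the `ε` in `ε / δ`. -/
theorem le_exp_add_rpow_mul {α : ℝ} (hα : 1 ≤ α) (ε : ℝ) (y : ℝ≥0∞) :
    y ≤ ENNReal.ofReal (Real.exp ε) + y ^ α * ENNReal.ofReal (Real.exp ((1 - α) * ε) / α) := by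
  have hα0 : 0 < α := by linarith
  induction y with
  | top =>
    rw [ENNReal.top_rpow_of_pos hα0, ENNReal.top_mul, add_top]
    exact (ENNReal.ofReal_pos.2 (by positivity)).ne'
  | coe y =>
    have hy : (y : ℝ≥0∞) = ENNReal.ofReal (y : ℝ) := by simp
    have hy0 : (0 : ℝ) ≤ y := y.2
    rw [hy, ENNReal.ofReal_rpow_of_nonneg hy0 hα0.le, ← ENNReal.ofReal_mul (by positivity),
      ← ENNReal.ofReal_add (by positivity) (by positivity)]
    refine ENNReal.ofReal_le_ofReal ?_
    have hb := one_add_mul_self_le_rpow_one_add (s := y / Real.exp ε - 1)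
      (by linarith [div_nonneg hy0 (Real.exp_pos ε).le]) hα
    rw [add_sub_cancel, Real.div_rpow hy0 (Real.exp_pos ε).le, ← Real.exp_mul] at hb
    have hE : Real.exp ((1 - α) * ε) = Real.exp ε / Real.exp (ε * α) := by
      rw [← Real.exp_sub]
      congr 1
      ring
    rw [hE]
    have h1 : y / Real.exp ε ≤ 1 + (y : ℝ) ^ α / Real.exp (ε * α) / α := by
      rw [← sub_le_iff_le_add', le_div_iff₀ hα0]
      linarith
    have h2 := (div_le_iff₀ (Real.exp_pos ε)).1 h1
    refine h2.trans (le_of_eq ?_)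
    ring

/-- From a bound on a moment of the density to approximate differential privacy. -/
theorem RenyiBounded.measure_le {α : ℝ} {C : ℝ≥0∞} {μ ν : Measure β} (h : RenyiBounded α C μ ν)
    (hα : 1 ≤ α) (ε : ℝ) {A : Set β} (hA : MeasurableSet A) :
    μ A ≤ ENNReal.ofReal (Real.exp ε) * ν A
      + C * ENNReal.ofReal (Real.exp ((1 - α) * ε) / α) := by
  obtain ⟨f, hf, rfl, hfC⟩ := h
  calc ν.withDensity f A = ∫⁻ x in A, f x ∂ν := withDensity_apply _ hA
    _ ≤ ∫⁻ x in A, (ENNReal.ofReal (Real.exp ε)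
          + f x ^ α * ENNReal.ofReal (Real.exp ((1 - α) * ε) / α)) ∂ν :=
        lintegral_mono fun x => le_exp_add_rpow_mul hα ε (f x)
    _ = ENNReal.ofReal (Real.exp ε) * ν A
          + (∫⁻ x in A, f x ^ α ∂ν) * ENNReal.ofReal (Real.exp ((1 - α) * ε) / α) := by
        rw [lintegral_add_left measurable_const, setLIntegral_const,
          lintegral_mul_const _ (hf.pow_const α)]
    _ ≤ _ := by
        gcongr
        exact (setLIntegral_le_lintegral _ _).trans hfC

/-- A bound on a moment of the density survives an injective post-processing. -/
theorem RenyiBounded.map {α : ℝ} {C : ℝ≥0∞} {μ ν : Measure β} (h : RenyiBounded α C μ ν)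
    {T : β → W} {T' : W → β} (hT : Measurable T) (hT' : Measurable T')
    (hTT' : Function.LeftInverse T' T) :
    RenyiBounded α C (μ.map T) (ν.map T) := by
  obtain ⟨f, hf, rfl, hfC⟩ := h
  refine ⟨f ∘ T', hf.comp hT', ?_, ?_⟩
  · ext A hA
    rw [Measure.map_apply hT hA, withDensity_apply _ (hT hA), withDensity_apply _ hA,
      setLIntegral_map hA (hf.comp hT') hT]
    simp only [Function.comp_apply, hTT' _]
  · rw [lintegral_map ((hf.comp hT').pow_const α) hT]
    simpa only [Function.comp_apply, hTT' _] using hfC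

/-- Adaptive composition: in the second component, `μ` gets noise with law `G` that is translated
by an amount depending on the first component. -/
theorem RenyiBounded.prod_shift [AddGroup E] [MeasurableAdd₂ E] {α : ℝ} (hα : 0 ≤ α)
    {C C' : ℝ≥0∞} {μ ν : Measure β} [SFinite μ] [SFinite ν] (h : RenyiBounded α C μ ν)
    {G : Measure E} [SFinite G] {d : β → E} (hd : Measurable d) {φ : E → E → ℝ≥0∞}
    (hφ : Measurable fun q : E × E => φ q.1 q.2)
    (hshift : ∀ x, G.map (· + d x) = G.withDensity (φ (d x)))
    (hmoment : ∀ x, ∫⁻ z, φ (d x) z ^ α ∂G ≤ C') :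
    RenyiBounded α (C * C') ((μ.prod G).map fun q => (q.1, q.2 + d q.1)) (ν.prod G) := by
  obtain ⟨f, hf, hμ, hfC⟩ := h
  have hφd : Measurable fun q : β × E => φ (d q.1) q.2 :=
    hφ.comp ((hd.comp measurable_fst).prodMk measurable_snd)
  have hF : Measurable fun q : β × E => f q.1 * φ (d q.1) q.2 :=
    (hf.comp measurable_fst).mul hφd
  have hR : Measurable fun q : β × E => (q.1, q.2 + d q.1) :=
    measurable_fst.prodMk (measurable_snd.add (hd.comp measurable_fst))
  have hφx : ∀ x, Measurable (φ (d x)) := fun x => hφ.comp measurable_prodMk_left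
  refine ⟨_, hF, ?_, ?_⟩
  · ext A hA
    rw [Measure.map_apply hR hA, Measure.prod_apply (hR hA), withDensity_apply _ hA,
      ← lintegral_indicator hA, lintegral_prod _ (hF.indicator hA).aemeasurable, hμ,
      lintegral_withDensity_eq_lintegral_mul _ hf (measurable_measure_prodMk_left (hR hA))]
    refine lintegral_congr fun x => ?_
    have hAx : MeasurableSet (Prod.mk x ⁻¹' A) := measurable_prodMk_left hA
    have h1 : G (Prod.mk x ⁻¹' ((fun q : β × E => (q.1, q.2 + d q.1)) ⁻¹' A))
        = ∫⁻ z in Prod.mk x ⁻¹' A, φ (d x) z ∂G := by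
      rw [← withDensity_apply _ hAx, ← hshift x, Measure.map_apply (measurable_add_const _) hAx]
      rfl
    rw [Pi.mul_apply, h1, ← lintegral_const_mul _ (hφx x), ← lintegral_indicator hAx]
    rfl
  · rw [lintegral_prod _ (hF.pow_const α).aemeasurable]
    -- The inner moment is bounded uniformly in the past `x`, so adaptivity costs nothing.
    calc ∫⁻ x, ∫⁻ z, (f x * φ (d x) z) ^ α ∂G ∂ν
        = ∫⁻ x, f x ^ α * ∫⁻ z, φ (d x) z ^ α ∂G ∂ν := by
          refine lintegral_congr fun x => ?_
          simp_rw [ENNReal.mul_rpow_of_nonneg _ _ hα]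
          exact lintegral_const_mul _ ((hφx x).pow_const α)
      _ ≤ ∫⁻ x, f x ^ α * C' ∂ν := by gcongr with x; exact hmoment x
      _ ≤ C * C' := by
          rw [lintegral_mul_const _ (hf.pow_const α)]
          gcongr

end Renyi

/-! ### Composition over the rounds. -/

section Releases

variable {P m nY : ℕ} {n : Fin P → ℕ}

/-- The derivative of any function is measurable, so no formula for the gradient is needed. -/
theorem measurable_localGradient {nX : ℕ} (γ : ℝ) (X : Mat m nX) :
    Measurable fun Y : Mat m nY => localGradient γ X Y :=
  (InnerProductSpace.toDual ℝ (Mat m nY)).symm.continuous.measurable.comp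
    (measurable_fderiv ℝ fun Z : Mat m nY => mmd γ X Z)

theorem measurable_snoc {α : Type*} [MeasurableSpace α] (s : ℕ) :
    Measurable fun q : (Fin s → α) × α => (Fin.snoc q.1 q.2 : Fin (s + 1) → α) := by
  refine measurable_pi_lambda _ fun i => ?_
  refine Fin.lastCases ?_ (fun j => ?_) i
  · simpa using measurable_snd
  · simpa [Function.comp_def] using (measurable_pi_apply (X := fun _ => α) j).comp measurable_fst

/-- The gradients of all clients in round `s`, given the earlier releases. -/
noncomputable def roundGradient (γ : ℝ) (Y : LandmarkRule P m nY) (X : ∀ p, Mat m (n p)) (s : ℕ)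
    (h : Fin s → Round P m nY) : Round P m nY :=
  fun p => localGradient γ (X p) (Y s h p)

theorem measurable_roundGradient (γ : ℝ) {Y : LandmarkRule P m nY} (X : ∀ p, Mat m (n p)) {s : ℕ}
    (hY : Measurable (Y s)) : Measurable (roundGradient γ Y X s) :=
  measurable_pi_lambda _ fun p =>
    (measurable_localGradient γ (X p)).comp ((measurable_pi_apply p).comp hY)

theorem measurable_releaseStep {s : ℕ} {g : (Fin s → Round P m nY) → Round P m nY}
    (hg : Measurable g) :
    Measurable fun hz : (Fin s → Round P m nY) × Round P m nY =>
      Fin.snoc (α := fun _ => Round P m nY) hz.1 (g hz.1 + hz.2) :=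
  (measurable_snoc s).comp (measurable_fst.prodMk ((hg.comp measurable_fst).add measurable_snd))

theorem releaseLaw_succ (γ : ℝ) (v : Fin P → ℝ≥0) (Y : LandmarkRule P m nY)
    (X : ∀ p, Mat m (n p)) (s : ℕ) :
    releaseLaw γ v Y X (s + 1)
      = ((releaseLaw γ v Y X s).prod (Measure.pi fun p => gaussianMatrix m nY (v p))).map
        fun hz => Fin.snoc (α := fun _ => Round P m nY) hz.1
          (roundGradient γ Y X s hz.1 + hz.2) :=
  rfl

theorem isProbabilityMeasure_releaseLaw (γ : ℝ) (v : Fin P → ℝ≥0) {Y : LandmarkRule P m nY}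
    (X : ∀ p, Mat m (n p)) (S : ℕ) (hY : ∀ s < S, Measurable (Y s)) :
    IsProbabilityMeasure (releaseLaw γ v Y X S) := by
  induction S with
  | zero => exact Measure.dirac.isProbabilityMeasure
  | succ s ih =>
    have := ih fun t ht => hY t (by omega)
    rw [releaseLaw_succ]
    exact Measure.isProbabilityMeasure_map
      (measurable_releaseStep (measurable_roundGradient γ X (hY s (by omega)))).aemeasurable

/-- Rényi privacy of the adaptive composition of `S` rounds. -/
theorem renyiBounded_releaseLaw (γ : ℝ) (v : Fin P → ℝ≥0) {Y : LandmarkRule P m nY}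
    (X X' : ∀ p, Mat m (n p)) {α ρ : ℝ} (hα : 1 ≤ α) (S : ℕ) (hY : ∀ s < S, Measurable (Y s))
    (hzero : ∀ s < S, ∀ h p, v p = 0 → roundGradient γ Y X s h p = roundGradient γ Y X' s h p)
    (hρ : ∀ s < S, ∀ h,
      ∑ p, ‖roundGradient γ Y X s h p - roundGradient γ Y X' s h p‖ ^ 2 / (2 * v p) ≤ ρ) :
    RenyiBounded α (ENNReal.ofReal (Real.exp (α * (α - 1) * (S * ρ))))
      (releaseLaw γ v Y X S) (releaseLaw γ v Y X' S) := by
  induction S with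
  | zero =>
    have := isProbabilityMeasure_releaseLaw γ v X 0 hY
    have h : RenyiBounded α 1 (releaseLaw γ v Y X 0) (releaseLaw γ v Y X' 0) :=
      RenyiBounded.refl α (releaseLaw γ v Y X 0)
    simpa using h
  | succ s ih =>
    have ih := ih (fun t ht => hY t (by omega)) (fun t ht => hzero t (by omega))
      fun t ht => hρ t (by omega)
    have := isProbabilityMeasure_releaseLaw γ v X s fun t ht => hY t (by omega)
    have := isProbabilityMeasure_releaseLaw γ v X' s fun t ht => hY t (by omega)
    have hg := measurable_roundGradient γ X (hY s (by omega))
    have hg' := measurable_roundGradient γ X' (hY s (by omega))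
    have hα0 : 0 ≤ α := by linarith
    -- The reference law is that of fresh noise under `X'`; the data `X` amount to translating this
    -- noise by the difference of the gradients.
    have hstep := ih.prod_shift hα0 (G := Measure.pi fun p => gaussianMatrix m nY (v p))
      (d := fun h => -roundGradient γ Y X' s h + roundGradient γ Y X s h) (hg'.neg.add hg)
      (measurable_roundShift v)
      (C' := ENNReal.ofReal (Real.exp (α * (α - 1) * ρ)))
      (fun h => map_add_pi_gaussianMatrix fun p hp => by
        simp [hzero s (by omega) h p hp])
      (fun h => by
        rw [lintegral_roundShift_rpow v _ hα0]
        refine ENNReal.ofReal_le_ofReal (Real.exp_le_exp.2 ?_)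
        refine mul_le_mul_of_nonneg_left ?_ (mul_nonneg hα0 (by linarith))
        refine (le_of_eq ?_).trans (hρ s (by omega) h)
        refine Finset.sum_congr rfl fun p _ => ?_
        simp [sub_eq_neg_add])
    -- Adding the gradient of `X'` turns noise into releases for both laws. This is invertible,
    -- since that gradient depends only on the earlier releases.
    have hmap := hstep.map (measurable_releaseStep hg')
      (T' := fun w => (Fin.init w, -roundGradient γ Y X' s (Fin.init w) + w (Fin.last s)))
      (by
        have hi : Measurable fun w : Fin (s + 1) → Round P m nY =>
            (Fin.init w : Fin s → Round P m nY) :=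
          measurable_pi_lambda _ fun j => measurable_pi_apply _
        exact hi.prodMk ((hg'.comp hi).neg.add (measurable_pi_apply _)))
      (fun q => by simp)
    have hR : Measurable fun q : (Fin s → Round P m nY) × Round P m nY =>
        (q.1, q.2 + (-roundGradient γ Y X' s q.1 + roundGradient γ Y X s q.1)) :=
      measurable_fst.prodMk (measurable_snd.add ((hg'.neg.add hg).comp measurable_fst))
    rw [Measure.map_map (measurable_releaseStep hg') hR] at hmap
    rw [← releaseLaw_succ, ← ENNReal.ofReal_mul (Real.exp_pos _).le, ← Real.exp_add] at hmap
    have hC : α * (α - 1) * (s * ρ) + α * (α - 1) * ρ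
        = α * (α - 1) * ((s + 1 : ℕ) * ρ) := by
      push_cast
      ring
    rw [hC] at hmap
    rw [releaseLaw_succ γ v Y X]
    convert hmap using 3 with q
    simp only [Function.comp_apply]
    congr 1
    abel

end Releases

/-! ### The Lipschitz estimate for the Gaussian kernel. -/

section Kernel

theorem hasDerivAt_mul_exp_neg_sq (γ r : ℝ) :
    HasDerivAt (fun r => r * Real.exp (-γ * r ^ 2))
      ((1 - 2 * (γ * r ^ 2)) * Real.exp (-γ * r ^ 2)) r := by
  have h := (hasDerivAt_id r).mul (((hasDerivAt_pow 2 r).const_mul (-γ)).exp)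
  refine h.congr_deriv ?_
  simp only [id, pow_one, Nat.cast_ofNat, Nat.add_one_sub_one]
  ring

theorem abs_mul_exp_neg_sq_sub_le {γ : ℝ} (hγ : 0 ≤ γ) (a b : ℝ) :
    |a * Real.exp (-γ * a ^ 2) - b * Real.exp (-γ * b ^ 2)| ≤ |a - b| := by
  have h := Convex.norm_image_sub_le_of_norm_hasDerivWithin_le (C := 1) (s := Set.univ)
    (fun r _ => (hasDerivAt_mul_exp_neg_sq γ r).hasDerivWithinAt) (fun r _ => ?_) convex_univ
    (Set.mem_univ b) (Set.mem_univ a)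
  · simpa using h
  · have ht : 0 ≤ γ * r ^ 2 := by positivity
    have he := Real.quadratic_le_exp_of_nonneg ht
    have hp := Real.exp_pos (-γ * r ^ 2)
    have hm : Real.exp (γ * r ^ 2) * Real.exp (-γ * r ^ 2) = 1 := by
      rw [← Real.exp_add]
      simp
    rw [Real.norm_eq_abs, abs_mul, abs_of_pos hp, ← hm]
    gcongr
    rw [abs_le]
    -- With `t = γr²`, the derivative bound `|1 - 2t| ≤ exp t` follows from `exp t ≥ 1 + t + t²/2`.
    constructor <;> nlinarith [sq_nonneg (γ * r ^ 2 - 1)]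

/-- The map `u ↦ exp (-γ ‖u‖²) u` is `1`-Lipschitz. -/
theorem norm_exp_smul_sub_le {V : Type*} [NormedAddCommGroup V] [InnerProductSpace ℝ V] {γ : ℝ}
    (hγ : 0 ≤ γ) (u w : V) :
    ‖Real.exp (-γ * ‖u‖ ^ 2) • u - Real.exp (-γ * ‖w‖ ^ 2) • w‖ ≤ ‖u - w‖ := by
  have h := sq_le_sq.2 (abs_mul_exp_neg_sq_sub_le hγ ‖u‖ ‖w‖)
  have hs : ∀ x : V, Real.exp (-γ * ‖x‖ ^ 2) ≤ 1 := fun x =>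
    Real.exp_le_one_iff.2 (by nlinarith [sq_nonneg ‖x‖, mul_nonneg hγ (sq_nonneg ‖x‖)])
  have hs0 := Real.exp_pos (-γ * ‖u‖ ^ 2)
  have ht0 := Real.exp_pos (-γ * ‖w‖ ^ 2)
  have hst : Real.exp (-γ * ‖u‖ ^ 2) * Real.exp (-γ * ‖w‖ ^ 2) ≤ 1 :=
    mul_le_one₀ (hs u) ht0.le (hs w)
  have hin := real_inner_le_norm u w
  rw [← sq_le_sq₀ (norm_nonneg _) (norm_nonneg _), @norm_sub_sq_real, @norm_sub_sq_real,
    real_inner_smul_left, real_inner_smul_right, norm_smul, norm_smul, Real.norm_of_nonneg hs0.le,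
    Real.norm_of_nonneg ht0.le]
  -- With weights `s`, `t`, the two squared norms are `(s‖u‖ - t‖w‖)² + 2st(‖u‖‖w‖ - ⟪u, w⟫)` and
  -- the same with `s = t = 1`. The radial parts compare by the scalar case, the angular parts by
  -- `st ≤ 1`.
  nlinarith [mul_nonneg (sub_nonneg.2 hst) (sub_nonneg.2 hin)]

end Kernel

/-! ### Sensitivity of the local gradient. -/

section Gradient

variable {m nX nY : ℕ}

/-- The `j`-th column, as a continuous linear map. -/
noncomputable def colL (j : Fin nY) : Mat m nY →L[ℝ] EuclideanSpace ℝ (Fin m) :=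
  LinearMap.toContinuousLinearMap
    { toFun := fun A => col A j
      map_add' := fun _ _ => rfl
      map_smul' := fun _ _ => rfl }

theorem colL_apply (A : Mat m nY) (j : Fin nY) : colL j A = col A j := rfl

theorem sum_norm_col_sq (A : Mat m nY) : ∑ j, ‖col A j‖ ^ 2 = ‖A‖ ^ 2 := by
  simp only [EuclideanSpace.real_norm_sq_eq, Fintype.sum_prod_type_right]
  rfl

theorem sum_norm_col_le (A : Mat m nY) : ∑ j, ‖col A j‖ ≤ √(nY : ℝ) * ‖A‖ := by
  refine le_of_sq_le_sq ?_ (by positivity)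
  rw [mul_pow, Real.sq_sqrt (Nat.cast_nonneg _), ← sum_norm_col_sq]
  simpa using sq_sum_le_card_mul_sum_sq (s := Finset.univ) (f := fun j => ‖col A j‖)

theorem hasFDerivAt_gaussianKernel_col (γ : ℝ) (x : EuclideanSpace ℝ (Fin m)) (Y : Mat m nY)
    (j : Fin nY) :
    HasFDerivAt (fun Z : Mat m nY => gaussianKernel γ x (col Z j))
      ((2 * γ) • (innerSL ℝ (Real.exp (-γ * ‖x - col Y j‖ ^ 2) • (x - col Y j))).comp (colL j))
      Y := by
  have h1 : HasFDerivAt (fun Z : Mat m nY => x - col Z j) (-colL j) Y :=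
    (colL j).hasFDerivAt.const_sub x
  have h2 := ((h1.norm_sq).const_mul (-γ)).exp
  refine h2.congr_fderiv ?_
  ext V
  simp
  ring

theorem differentiableAt_gaussianKernel_col_col (γ : ℝ) (Y : Mat m nY) (i j : Fin nY) :
    DifferentiableAt ℝ (fun Z : Mat m nY => gaussianKernel γ (col Z i) (col Z j)) Y := by
  have h1 : DifferentiableAt ℝ (fun Z : Mat m nY => col Z i - col Z j) Y :=
    ((colL i).hasFDerivAt.sub (colL j).hasFDerivAt).differentiableAt
  exact ((h1.norm_sq ℝ).const_mul (-γ)).exp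

theorem differentiableAt_mmd (γ : ℝ) (X : Mat m nX) (Y : Mat m nY) :
    DifferentiableAt ℝ (fun Z : Mat m nY => mmd γ X Z) Y := by
  refine ((differentiableAt_const _).sub (DifferentiableAt.const_mul ?_ _)).add
    (DifferentiableAt.const_mul ?_ _)
  · exact DifferentiableAt.fun_sum fun i _ => DifferentiableAt.fun_sum fun j _ =>
      (hasFDerivAt_gaussianKernel_col γ (col X i) Y j).differentiableAt
  · exact DifferentiableAt.fun_sum fun i _ => DifferentiableAt.fun_sum fun j _ =>
      differentiableAt_gaussianKernel_col_col γ Y i j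

/-- The landmark–landmark terms cancel and the data–data terms do not involve `Z`; only the cross
terms of the changed point remain to be differentiated. -/
theorem mmd_sub_mmd {X X' : Mat m nX} {i : Fin nX} (h : ∀ k, k ≠ i → col X k = col X' k) (γ : ℝ) :
    ∃ c : ℝ, ∀ Z : Mat m nY, mmd γ X Z - mmd γ X' Z = c - 2 / ((nX : ℝ) * (nY : ℝ)) *
      ∑ j, (gaussianKernel γ (col X i) (col Z j) - gaussianKernel γ (col X' i) (col Z j)) := by
  refine ⟨1 / ((nX : ℝ) * ((nX : ℝ) - 1)) *
      ∑ i : Fin nX, ∑ j ∈ Finset.univ.filter (fun j => j ≠ i), gaussianKernel γ (col X i) (col X j)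
    - 1 / ((nX : ℝ) * ((nX : ℝ) - 1)) *
      ∑ i : Fin nX, ∑ j ∈ Finset.univ.filter (fun j => j ≠ i),
        gaussianKernel γ (col X' i) (col X' j), fun Z => ?_⟩
  have hs : ∑ k, ∑ j, gaussianKernel γ (col X k) (col Z j)
      - ∑ k, ∑ j, gaussianKernel γ (col X' k) (col Z j)
      = ∑ j, (gaussianKernel γ (col X i) (col Z j) - gaussianKernel γ (col X' i) (col Z j)) := by
    rw [← Finset.sum_sub_distrib, Finset.sum_eq_single i, ← Finset.sum_sub_distrib]
    · intro k _ hk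
      rw [h k hk, sub_self]
    · simp
  rw [← hs, mmd, mmd]
  ring

/-- Changing one data point moves the local gradient by at most a multiple of its displacement. -/
theorem norm_localGradient_sub_le {γ : ℝ} (hγ : 0 ≤ γ) {X X' : Mat m nX} {i : Fin nX}
    (h : ∀ k, k ≠ i → col X k = col X' k) (Y : Mat m nY) :
    ‖localGradient γ X Y - localGradient γ X' Y‖
      ≤ 4 * √(nY : ℝ) * γ / ((nX : ℝ) * (nY : ℝ)) * ‖col X i - col X' i‖ := by
  obtain ⟨c, hc⟩ := mmd_sub_mmd (nY := nY) h γ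
  have hd : HasFDerivAt (fun Z : Mat m nY => mmd γ X Z - mmd γ X' Z) _ Y :=
    (differentiableAt_mmd γ X Y).hasFDerivAt.sub (differentiableAt_mmd γ X' Y).hasFDerivAt
  have hd' := ((HasFDerivAt.fun_sum fun j (_ : j ∈ Finset.univ) =>
    (hasFDerivAt_gaussianKernel_col γ (col X i) Y j).sub
      (hasFDerivAt_gaussianKernel_col γ (col X' i) Y j)).const_mul
        (2 / ((nX : ℝ) * (nY : ℝ)))).const_sub c
  rw [funext hc] at hd
  have heq := hd.unique hd'
  -- By the Riesz isometry the claim becomes an operator norm bound for a difference of derivatives.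
  rw [← (InnerProductSpace.toDual ℝ (Mat m nY)).norm_map, map_sub, localGradient, localGradient,
    toDual_gradient, toDual_gradient, heq]
  refine ContinuousLinearMap.opNorm_le_bound _ (by positivity) fun V => ?_
  set u : Fin nY → EuclideanSpace ℝ (Fin m) := fun j =>
    Real.exp (-γ * ‖col X i - col Y j‖ ^ 2) • (col X i - col Y j)
      - Real.exp (-γ * ‖col X' i - col Y j‖ ^ 2) • (col X' i - col Y j) with hu
  have hu_le : ∀ j, ‖u j‖ ≤ ‖col X i - col X' i‖ := fun j => by
    have := norm_exp_smul_sub_le hγ (col X i - col Y j) (col X' i - col Y j)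
    rwa [sub_sub_sub_cancel_right] at this
  calc _ = 2 / ((nX : ℝ) * (nY : ℝ)) * (2 * γ) * |∑ j, inner ℝ (u j) (col V j)| := by
        rw [← abs_of_nonneg (show 0 ≤ 2 / ((nX : ℝ) * (nY : ℝ)) * (2 * γ) by positivity),
          ← abs_mul, ← Real.norm_eq_abs, ← norm_neg]
        congr 1
        simp only [neg_apply, smul_apply, neg_neg,
          sum_apply, sub_apply, smul_eq_mul,
          ContinuousLinearMap.comp_apply, innerSL_apply_apply, colL_apply, hu, inner_sub_left,
          ← mul_sub, ← Finset.mul_sum, mul_assoc]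
    _ ≤ 2 / ((nX : ℝ) * (nY : ℝ)) * (2 * γ) * ∑ j, ‖col X i - col X' i‖ * ‖col V j‖ := by
        gcongr
        refine (Finset.abs_sum_le_sum_abs _ _).trans (Finset.sum_le_sum fun j _ => ?_)
        exact (abs_real_inner_le_norm _ _).trans (by gcongr; exact hu_le j)
    _ ≤ 2 / ((nX : ℝ) * (nY : ℝ)) * (2 * γ) * (‖col X i - col X' i‖ * (√(nY : ℝ) * ‖V‖)) := by
        rw [← Finset.mul_sum]
        gcongr
        exact sum_norm_col_le V
    _ = _ := by ring

theorem norm_localGradient_sub_le_sensitivityBound {γ τX τY Υ : ℝ} (hγ : 0 ≤ γ) {Y : Mat m nY}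
    (hY : spectralNorm Y ≤ τY) {X X' : Mat m nX} (hX : X ∈ localDomain τX Υ Y)
    (hX' : X' ∈ localDomain τX Υ Y) (hadj : ColumnAdjacent X X') :
    ‖localGradient γ X Y - localGradient γ X' Y‖ ≤ sensitivityBound nX nY γ τX τY Υ := by
  obtain ⟨i, hi⟩ := hadj
  have hτX : 0 ≤ τX := (norm_nonneg _).trans (hX.1 i)
  have hτY : 0 ≤ τY := (norm_nonneg _).trans hY
  have hle := norm_localGradient_sub_le hγ hi Y
  -- Without landmarks the sign of `Υ` is unknown, but both bounds vanish.
  obtain rfl | hn := Nat.eq_zero_or_pos nY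
  · refine hle.trans (le_of_eq ?_)
    simp [sensitivityBound]
  have hΥ : 0 ≤ Υ := (norm_nonneg _).trans (hX.2 ⟨0, hn⟩ i)
  have hdist : ‖col X i - col X' i‖ ≤ 2 * τX := by
    linarith [norm_sub_le (col X i) (col X' i), hX.1 i, hX'.1 i]
  calc _ ≤ 4 * √(nY : ℝ) * γ / ((nX : ℝ) * (nY : ℝ)) * (2 * τX) := by
        refine hle.trans ?_
        gcongr
    _ = 8 * √(nY : ℝ) * γ * τX / ((nX : ℝ) * (nY : ℝ)) * 1 := by ring
    _ ≤ sensitivityBound nX nY γ τX τY Υ := by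
        unfold sensitivityBound
        gcongr
        linarith [show 0 ≤ 2 * γ * (τX + τY) * (τX + Υ) by positivity]

end Gradient

/-! ### Calibration of the noise and conclusion. -/

theorem l2Sensitivity_localGradient_le {m nX nY : ℕ} {γ τX τY Υ : ℝ} (hγ : 0 ≤ γ) {Y : Mat m nY}
    (hY : spectralNorm Y ≤ τY) :
    l2Sensitivity (localDomain τX Υ Y) ColumnAdjacent (fun X : Mat m nX => localGradient γ X Y)
      ≤ ENNReal.ofReal (sensitivityBound nX nY γ τX τY Υ) := by
  refine iSup₂_le fun X hX => iSup₂_le fun X' hX' => iSup_le fun hadj => ?_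
  rw [edist_dist, dist_eq_norm]
  exact ENNReal.ofReal_le_ofReal (norm_localGradient_sub_le_sensitivityBound hγ hY hX hX' hadj)

/-- The privacy budget spent by one of `S` rounds with the given noise variance. -/
theorem sq_div_noiseVariance_le {S : ℕ} (hS : 0 < S) {x Δ ε δ : ℝ} (hx : x ^ 2 ≤ Δ ^ 2) (hε : 0 < ε)
    (hL : 0 < Real.log (Real.exp 1 + ε / δ)) :
    x ^ 2 / (2 * noiseVariance S Δ ε δ)
      ≤ ε ^ 2 / (16 * Real.log (Real.exp 1 + ε / δ)) / S := by
  have hS' : (0 : ℝ) < S := by exact_mod_cast hS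
  rw [noiseVariance, Real.coe_toNNReal _ (by positivity)]
  -- If `Δ = 0` the variance is `0` and the quotient on the left is `0` by convention.
  obtain hΔ | hΔ := (sq_nonneg Δ).eq_or_lt
  · rw [← hΔ]
    simp only [mul_zero, zero_mul, zero_div, div_zero]
    positivity
  · calc _ ≤ Δ ^ 2 / (2 * (8 * S * Δ ^ 2 * Real.log (Real.exp 1 + ε / δ) / ε ^ 2)) := by gcongr
      _ = _ := by
        have hΔ0 : Δ ≠ 0 := by
          rintro rfl
          simp at hΔ
        field_simp
        norm_num

/-- Degenerate noise is harmless: it occurs only if `Δ = 0`, and then the gradients agree and no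
translation is needed. -/
theorem eq_zero_of_noiseVariance_eq_zero {S : ℕ} (hS : 0 < S) {x Δ ε δ : ℝ} (hx : x ^ 2 ≤ Δ ^ 2)
    (hε : 0 < ε) (hL : 0 < Real.log (Real.exp 1 + ε / δ)) (h : noiseVariance S Δ ε δ = 0) :
    x = 0 := by
  have hS' : (0 : ℝ) < S := by exact_mod_cast hS
  by_contra hx0
  have hΔ : 0 < Δ ^ 2 := (by positivity : 0 < x ^ 2).trans_le hx
  rw [noiseVariance, Real.toNNReal_eq_zero] at h
  exact absurd h (not_le.2 (by positivity))

/-- At the order `1 / 2 + 8 L / ε`, a Rényi budget of `ε² / (16 L)` per unit of order gives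
`(ε, δ)`-privacy. -/
theorem renyi_to_delta_le {ε δ L : ℝ} (hε : 0 < ε) (hδ : 0 < δ)
    (hL : L = Real.log (Real.exp 1 + ε / δ)) (hL1 : 1 ≤ L) (hεL : ε ≤ 8 * L) {α : ℝ}
    (hα : α = 1 / 2 + 8 * L / ε) :
    Real.exp (α * (α - 1) * (ε ^ 2 / (16 * L))) * (Real.exp ((1 - α) * ε) / α) ≤ δ := by
  have hL0 : 0 < L := by linarith
  have hα8 : 8 / ε ≤ α := by
    have : 8 / ε ≤ 8 * L / ε := by
      gcongr
      linarith
    linarith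
  have hα0 : 0 < α := (by positivity : 0 < 8 / ε).trans_le hα8
  have hexp : α * (α - 1) * (ε ^ 2 / (16 * L)) + (1 - α) * ε ≤ -L := by
    -- The chosen `α` minimizes this quadratic in `α`; the minimum is at most `-L` because `ε ≤ 8L`
    -- gives `16L - ε ≥ 8L`.
    have h : α * (α - 1) * (ε ^ 2 / (16 * L)) + (1 - α) * ε = -((16 * L - ε) ^ 2 / (64 * L)) := by
      rw [hα]
      field_simp
      ring
    rw [h, neg_le_neg_iff, le_div_iff₀ (by positivity)]
    nlinarith
  calc _ = Real.exp (α * (α - 1) * (ε ^ 2 / (16 * L)) + (1 - α) * ε) / α := by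
        rw [Real.exp_add, mul_div_assoc]
    _ ≤ Real.exp (-L) / (8 / ε) := by gcongr
    _ = (Real.exp 1 + ε / δ)⁻¹ / (8 / ε) := by
        rw [Real.exp_neg, hL, Real.exp_log (by positivity)]
    _ ≤ (ε / δ)⁻¹ / (8 / ε) := by
        gcongr
        linarith [Real.exp_pos 1]
    _ = δ / 8 := by field_simp
    _ ≤ δ := by linarith

theorem isDifferentiallyPrivate_releaseLaw {P m nY : ℕ} {n : Fin P → ℕ} {γ τX τY Υ : ℝ}
    (hγ : 0 ≤ γ) {S : ℕ} {Y : LandmarkRule P m nY} (hY : ∀ s < S, Measurable (Y s))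
    (hτ : ∀ s < S, ∀ h p, spectralNorm (Y s h p) ≤ τY) {ε δ : ℝ} (hε : 0 < ε) (hδ : 0 < δ)
    (hεL : ε ≤ 8 * Real.log (Real.exp 1 + ε / δ)) :
    IsDifferentiallyPrivate (dataDomain (n := n) S τX Υ Y) Adjacent
      (fun X => releaseLaw γ
        (fun p => noiseVariance S (sensitivityBound (n p) nY γ τX τY Υ) ε δ) Y X S) ε δ := by
  refine ⟨fun X _ => isProbabilityMeasure_releaseLaw γ _ X S hY, fun X hX X' hX' hadj E hE => ?_⟩
  set L := Real.log (Real.exp 1 + ε / δ) with hL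
  have hL1 : 1 ≤ L := by
    rw [hL, Real.le_log_iff_exp_le (by positivity)]
    linarith [div_pos hε hδ]
  have hL0 : 0 < L := by linarith
  set α := 1 / 2 + 8 * L / ε with hα
  have hα1 : 1 ≤ α := by
    have := (one_le_div hε).2 hεL
    linarith
  obtain ⟨p, hp, hq⟩ := hadj
  have hdiff : ∀ s < S, ∀ h,
      ‖roundGradient γ Y X s h p - roundGradient γ Y X' s h p‖ ^ 2
        ≤ sensitivityBound (n p) nY γ τX τY Υ ^ 2 := fun s hs h => by
    have := norm_localGradient_sub_le_sensitivityBound hγ (hτ s hs h p)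
      (X := X p) (X' := X' p) ⟨hX.1 p, hX.2 s hs h p⟩ ⟨hX'.1 p, hX'.2 s hs h p⟩ hp
    exact pow_le_pow_left₀ (norm_nonneg _) this 2
  have hother : ∀ s h, ∀ q ≠ p, roundGradient γ Y X s h q = roundGradient γ Y X' s h q :=
    fun s h q hqp => by simp only [roundGradient, hq q hqp]
  have hρ : (S : ℝ) * (ε ^ 2 / (16 * L) / S) ≤ ε ^ 2 / (16 * L) := by
    obtain rfl | hS := Nat.eq_zero_or_pos S
    · simp only [Nat.cast_zero, zero_mul]
      positivity
    · have : (S : ℝ) ≠ 0 := by exact_mod_cast hS.ne'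
      exact (mul_div_cancel₀ _ this).le
  have hR := renyiBounded_releaseLaw γ
    (fun p => noiseVariance S (sensitivityBound (n p) nY γ τX τY Υ) ε δ) X X' hα1 S hY
    (ρ := ε ^ 2 / (16 * L) / S)
    (fun s hs h q hv => by
      obtain rfl | hqp := eq_or_ne q p
      · exact sub_eq_zero.1 (norm_eq_zero.1
          (eq_zero_of_noiseVariance_eq_zero (by omega) (hdiff s hs h) hε hL0 hv))
      · exact hother s h q hqp)
    (fun s hs h => by
      -- Only the client with the changed column contributes, so the budget does not grow with `P`.
      rw [Finset.sum_eq_single p (fun q _ hqp => by simp [hother s h q hqp]) (by simp)]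
      exact sq_div_noiseVariance_le (by omega) (hdiff s hs h) hε hL0)
  refine (hR.measure_le hα1 ε hE).trans ?_
  gcongr
  rw [← ENNReal.ofReal_mul (Real.exp_pos _).le]
  refine ENNReal.ofReal_le_ofReal (le_trans ?_ (renyi_to_delta_le hε hδ hL hL1 hεL hα))
  have : 0 ≤ α * (α - 1) := mul_nonneg (by linarith) (by linarith)
  gcongr

end FedDL

theorem mainTheorem4 (P m nY : ℕ) (n : Fin P → ℕ) (γ τX τY Υ : ℝ) (hγ : 0 < γ) :
    -- the sensitivity of the local gradients
    (∀ p : Fin P, ∀ Y₀ : FedDL.Mat m nY, FedDL.spectralNorm Y₀ ≤ τY →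
      FedDL.l2Sensitivity (FedDL.localDomain τX Υ Y₀) FedDL.ColumnAdjacent
          (fun X : FedDL.Mat m (n p) => FedDL.localGradient γ X Y₀)
        ≤ ENNReal.ofReal (FedDL.sensitivityBound (n p) nY γ τX τY Υ)) ∧
    -- privacy of the releases of all clients in `S` rounds
    (∀ (S : ℕ) (Y : FedDL.LandmarkRule P m nY),
      (∀ s < S, Measurable (Y s)) →
      (∀ s < S, ∀ h p, FedDL.spectralNorm (Y s h p) ≤ τY) →
      ∀ ε δ : ℝ, 0 < ε → 0 < δ → δ ≤ 1 → ε ≤ 8 * Real.log (Real.exp 1 + ε / δ) →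
        FedDL.IsDifferentiallyPrivate
          (FedDL.dataDomain (n := n) S τX Υ Y) FedDL.Adjacent
          (fun X => FedDL.releaseLaw γ
            (fun p => FedDL.noiseVariance S (FedDL.sensitivityBound (n p) nY γ τX τY Υ) ε δ)
            Y X S)
          ε δ) := by
  exact ⟨fun p Y₀ hY₀ => FedDL.l2Sensitivity_localGradient_le hγ.le hY₀,
    fun S Y hY hτ ε δ hε hδ _ hεL =>
      FedDL.isDifferentiallyPrivate_releaseLaw hγ.le hY hτ hε hδ hεL⟩
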